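/- Let $2\le k\le n-1$. Let $K\subset\mathbb R^n$ be a star body, i.e. a compact set with the origin in its interior that is star-shaped with respect to the origin and whose radial function $\rho_K(\theta)=\max\{r\ge 0: r\theta\in K\}$, $\theta\in S^{n-1}$, is continuous. Let $G_{n,k}$ be the Grassmannian of $k$-dimensional linear subspaces of $\mathbb R^n$ with its $O(n)$-invariant measure, and for functions $f$ on $S^{n-1}$ let $$(F_kf)(\xi)=\int_{S^{n-1}\cap\xi}f(\theta)\,d_\xi\theta,\qquad \xi\in G_{n,k},$$ where $d_\xi\theta$ is the $(k-1)$-dimensional surface element. For a function $\varphi$ defined almost everywhere on $G_{n,k}$, a version of $F_k^{-1}\varphi$ is an even integrable function $g$ on $S^{n-1}$ such that $F_kg=\varphi$ almost everywhere on $G_{n,k}$. For a sign $\pm$ put $S^{n-1}_\pm=\{\theta\in S^{n-1}:\pm\theta_n>0\}$ and, for $\xi\in G_{n,k}$ not orthogonal to $e_n=(0,\dots,0,1)$ (this is almost every $\xi$), $$v^\pm(\xi)=\mathrm{vol}_k(K\cap\xi_\pm),\qquad \xi_\pm=\{x\in\xi:\pm x_n>0\}.$$ Then, for each of the two signs, $F_k^{-1}v^\pm$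 exists and has a version that is continuous on $S^{n-1}_\pm$. Every version of it satisfies $$\rho_K(\theta)^k=2k\,(F_k^{-1}v^\pm)(\theta)$$ for almost every $\theta\in S^{n-1}_\pm$, and every version that is continuous on $S^{n-1}_\pm$ satisfies this for every $\theta\in S^{n-1}_\pm$. On the equator the radial function is obtained by continuity: if $\theta_n=0$, then for every version that is continuous on $S^{n-1}_\pm$, $$\rho_K(\theta)^k=\lim_{\eta\to\theta,\ \eta\in S^{n-1}_\pm}2k\,(F_k^{-1}v^\pm)(\eta).$$ -/

import Mathlib

open MeasureTheory Set Filter Topology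

noncomputable section

namespace HalfSection

/-- The Euclidean space `ℝⁿ`. -/
abbrev Euc (n : ℕ) : Type := EuclideanSpace ℝ (Fin n)

/-- The unit sphere `Sⁿ⁻¹` of `ℝⁿ`. -/
abbrev Sph (n : ℕ) : Type := Metric.sphere (0 : Euc n) 1

/-- The surface measure on `Sⁿ⁻¹` (total mass `n` times the volume of the unit ball). -/
def surfaceMeasure (n : ℕ) : Measure (Sph n) := (volume : Measure (Euc n)).toSphere

/-! ### Star bodies -/

/-- The radial function `ρ_K(θ) = max {r ≥ 0 : rθ ∈ K}`. For a compact `K` that contains the origin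
the set is compact and nonempty, so that its supremum is a maximum. -/
def radialFun {n : ℕ} (K : Set (Euc n)) (θ : Sph n) : ℝ :=
  sSup {r : ℝ | 0 ≤ r ∧ r • (θ : Euc n) ∈ K}

/-- A star body: a compact set with the origin in its interior that is star-shaped with respect
to the origin and has a continuous radial function. -/
structure IsStarBody {n : ℕ} (K : Set (Euc n)) : Prop where
  isCompact : IsCompact K
  zero_mem_interior : (0 : Euc n) ∈ interior K
  starConvex : StarConvex ℝ 0 K
  continuous_radialFun : Continuous (radialFun K)

/-! ### The Grassmannian and its invariant measure -/

/-- The Grassmannian of all `k`-dimensional linear subspaces of `ℝⁿ`. -/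
def Grass (n k : ℕ) : Type := {ξ : Submodule ℝ (Euc n) // Module.finrank ℝ ξ = k}

/-- The usual topology of the Grassmannian: a subspace is identified with the orthogonal
projection onto it. -/
instance (n k : ℕ) : TopologicalSpace (Grass n k) :=
  TopologicalSpace.induced (fun ξ => ξ.1.starProjection) inferInstance

instance (n k : ℕ) : MeasurableSpace (Grass n k) := borel _

instance (n k : ℕ) : BorelSpace (Grass n k) := ⟨rfl⟩

/-- The orthogonal group `O(n)`, with the topology of the operator norm. -/
abbrev OrthGroup (n : ℕ) : Type := unitary (Euc n →L[ℝ] Euc n)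

instance (n : ℕ) : ContinuousStar (Euc n →L[ℝ] Euc n) :=
  ⟨(ContinuousLinearMap.adjoint (𝕜 := ℝ) (E := Euc n) (F := Euc n)).continuous⟩

instance (n : ℕ) : CompactSpace (OrthGroup n) := by
  have : ProperSpace (Euc n →L[ℝ] Euc n) := FiniteDimensional.proper ℝ _
  refine isCompact_iff_compactSpace.mp (Metric.isCompact_of_isClosed_isBounded
    (isClosed_unitary (R := Euc n →L[ℝ] Euc n)) ?_)
  refine (Metric.isBounded_closedBall (x := (0 : Euc n →L[ℝ] Euc n)) (r := 1)).subset ?_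
  intro T hT
  rw [mem_closedBall_zero_iff]
  refine ContinuousLinearMap.opNorm_le_bound _ zero_le_one fun x => ?_
  rw [one_mul]
  exact ((Unitary.linearIsometryEquiv ⟨T, hT⟩).norm_map x).le

/-- The image `Tξ` of a subspace `ξ` under an orthogonal map `T`. -/
def rotate {n k : ℕ} (T : OrthGroup n) (ξ : Grass n k) : Grass n k :=
  ⟨ξ.1.map (Unitary.linearIsometryEquiv T).toLinearEquiv.toLinearMap,
    (LinearEquiv.finrank_map_eq _ _).trans ξ.2⟩

/-- The subspace spanned by the first `k` coordinate vectors of `ℝⁿ`. -/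
def coordSubspace {n k : ℕ} (h : k ≤ n) : Grass n k :=
  ⟨Submodule.span ℝ (range fun i : Fin k => EuclideanSpace.basisFun (Fin n) ℝ (Fin.castLE h i)), by
    have hli := (EuclideanSpace.basisFun (Fin n) ℝ).orthonormal.linearIndependent.comp
      (Fin.castLE h) (Fin.castLE_injective h)
    exact (finrank_span_eq_card hli).trans (Fintype.card_fin k)⟩

theorem continuous_rotate {n k : ℕ} (ξ : Grass n k) :
    Continuous fun T : OrthGroup n => rotate T ξ := by
  refine continuous_induced_rng.mpr ?_
  have h : ((fun η : Grass n k => η.1.starProjection) ∘ fun T : OrthGroup n => rotate T ξ) =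
      fun T : OrthGroup n =>
        (T : Euc n →L[ℝ] Euc n) * ξ.1.starProjection * ((star T : OrthGroup n) : Euc n →L[ℝ] Euc n) := by
    funext T
    ext1 x
    exact Submodule.starProjection_map_apply (Unitary.linearIsometryEquiv T) ξ.1 x
  rw [h]
  exact (continuous_subtype_val.mul continuous_const).mul
    (continuous_subtype_val.comp continuous_star)

/-- The `O(n)`-invariant measure on the Grassmannian: the image of the Haar measure of `O(n)`
under `T ↦ Tξ₀`, where `ξ₀` is a coordinate subspace. -/
def grassMeasure {n k : ℕ} (h : k ≤ n) : Measure (Grass n k) :=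
  (Measure.haar : Measure (OrthGroup n)).map fun T => rotate T (coordSubspace h)

/-! ### The Funk transform and its inverse -/

/-- The inclusion of the unit sphere of a subspace `ξ` into `Sⁿ⁻¹`, with image `Sⁿ⁻¹ ∩ ξ`. -/
def sphereIncl {n : ℕ} (ξ : Submodule ℝ (Euc n)) (θ : Metric.sphere (0 : ξ) 1) : Sph n :=
  ⟨((θ : ξ) : Euc n), mem_sphere_zero_iff_norm.mpr (norm_eq_of_mem_sphere θ)⟩

/-- The Funk transform `(F_k f)(ξ) = ∫_{Sⁿ⁻¹ ∩ ξ} f(θ) d_ξθ`, where `d_ξθ` is the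
`(k-1)`-dimensional surface element of the unit sphere of the Euclidean space `ξ`. -/
def funk {n k : ℕ} (f : Sph n → ℝ) (ξ : Grass n k) : ℝ :=
  ∫ θ, f (sphereIncl ξ.1 θ) ∂((volume : Measure ξ.1).toSphere)

/-- `g` is (a version of) `F_k⁻¹ φ`: an even integrable function on `Sⁿ⁻¹` whose Funk transform
is `φ`, almost everywhere on the Grassmannian. -/
structure IsFunkInverse {n k : ℕ} (h : k ≤ n) (φ : Grass n k → ℝ) (g : Sph n → ℝ) : Prop where
  even : ∀ θ, g (-θ) = g θ
  integrable : Integrable g (surfaceMeasure n)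
  funk_eq : funk g =ᵐ[grassMeasure h] φ

/-! ### Half-sections; the last coordinate of a point `x` of `ℝᵐ⁺¹` is `x (Fin.last m)` -/

/-- The open hemisphere `{θ : ±θ_n > 0}`; the sign is `ε = 1` or `ε = -1`. -/
def hemisphere (m : ℕ) (ε : ℝ) : Set (Sph (m + 1)) :=
  {θ | 0 < ε * (θ : Euc (m + 1)) (Fin.last m)}

/-- The volume `v^±(ξ) = vol_k(K ∩ ξ_±)` of the half-section of `K` by
`ξ_± = {x ∈ ξ : ±x_n > 0}`, with respect to Lebesgue measure on the Euclidean space `ξ`;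
the sign is `ε = 1` or `ε = -1`. -/
def halfSectionVolume {m k : ℕ} (ε : ℝ) (K : Set (Euc (m + 1))) (ξ : Grass (m + 1) k) : ℝ :=
  (volume : Measure ξ.1).real
    {x | (x : Euc (m + 1)) ∈ K ∧ 0 < ε * (x : Euc (m + 1)) (Fin.last m)}

end HalfSection

end

/-! Existence is polar coordinates in `ξ`: `v^±(ξ)` is the integral of `ρ_K^k / k` over the part of
the unit sphere of `ξ` in the open hemisphere. Spreading this density evenly over a point and its
antipode changes no integral over a central section, so the even function `evenRadialPow`, equal to
`ρ_K^k / (2k)` on the hemisphere, has Funk transform `v^±`.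

Everything else follows from injectivity of the Funk transform on even integrable functions
(`IsFunkInverse.ae_unique`). Let `d` be even with vanishing integrals over almost all `TW`, where
`W` is a fixed proper subspace. Weighting by powers of the distance from `x` to `TW` and averaging
over `T` gives `∫ d(θ) (‖x‖² - ⟨x,θ⟩²)^j = 0` for all `x` and `j` (`integral_mul_pow_eq_zero`).
Hence all even moments `∫ d(θ) ⟨x,θ⟩^(2j)` vanish, and so does the cosine transform; the sine
transform vanishes by parity. Uniqueness of characteristic functions gives `d = 0` almost
everywhere. -/

noncomputable section

namespace HalfSection

/-! ### Surface measure on unit spheres and polar coordinates. -/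

section Sphere

variable {E F : Type*} [NormedAddCommGroup E] [InnerProductSpace ℝ E]
  [NormedAddCommGroup F] [InnerProductSpace ℝ F]

/-- The map between unit spheres induced by a linear isometry. -/
def sphereMap (L : E ≃ₗᵢ[ℝ] F) (θ : Metric.sphere (0 : E) 1) : Metric.sphere (0 : F) 1 :=
  ⟨L θ, by simp⟩

theorem continuous_sphereMap (L : E ≃ₗᵢ[ℝ] F) : Continuous (sphereMap L) :=
  (L.continuous.comp continuous_subtype_val).subtype_mk _

variable [FiniteDimensional ℝ E] [MeasurableSpace E] [BorelSpace E]
  [FiniteDimensional ℝ F] [MeasurableSpace F] [BorelSpace F]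

/-- Linear isometries preserve the surface measure of the unit sphere. -/
theorem measurePreserving_sphereMap (L : E ≃ₗᵢ[ℝ] F) :
    MeasurePreserving (sphereMap L) (volume : Measure E).toSphere
      (volume : Measure F).toSphere := by
  refine ⟨(continuous_sphereMap L).measurable, ?_⟩
  ext s hs
  rw [Measure.map_apply (continuous_sphereMap L).measurable hs,
    Measure.toSphere_apply' _ hs,
    Measure.toSphere_apply' _ ((continuous_sphereMap L).measurable hs),
    L.toLinearEquiv.finrank_eq]
  congr 1
  rw [← L.measurePreserving.measure_preimage_emb L.toMeasurableEquiv.measurableEmbedding]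
  congr 1
  ext y
  simp only [mem_preimage, Set.mem_smul]
  constructor
  · rintro ⟨r, hr, _, ⟨θ, hθ, rfl⟩, rfl⟩
    exact ⟨r, hr, _, ⟨_, hθ, rfl⟩, by simp [sphereMap]⟩
  · rintro ⟨r, hr, _, ⟨θ, hθ, rfl⟩, h⟩
    have hL : L (L.symm (θ : F)) = θ := L.apply_symm_apply _
    refine ⟨r, hr, L.symm θ, ⟨⟨L.symm θ, by simp⟩, ?_, rfl⟩, ?_⟩
    · simpa [sphereMap] using hθ
    · apply L.injective
      exact (map_smul L _ _).trans ((congrArg (r • ·) hL).trans h)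

/-- The antipodal map preserves the surface measure of the unit sphere. -/
theorem measurePreserving_neg_sphere :
    MeasurePreserving (fun θ : Metric.sphere (0 : E) 1 => -θ) (volume : Measure E).toSphere
      (volume : Measure E).toSphere := by
  convert measurePreserving_sphereMap (LinearIsometryEquiv.neg ℝ (E := E)) using 2
  exact Subtype.ext (by simp [sphereMap])

theorem integral_sphere_neg (f : Metric.sphere (0 : E) 1 → ℝ) :
    ∫ θ, f (-θ) ∂(volume : Measure E).toSphere = ∫ θ, f θ ∂(volume : Measure E).toSphere :=
  measurePreserving_neg_sphere.integral_comp
    (Homeomorph.neg (Metric.sphere (0 : E) 1)).measurableEmbedding f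

/-- The radial measure has a density with respect to Lebesgue measure, so including the endpoint `a`
costs nothing. -/
theorem volumeIoiPow_le (d : ℕ) {a : ℝ} (ha : 0 ≤ a) :
    Measure.volumeIoiPow d {r | (r : ℝ) ≤ a} = ENNReal.ofReal (a ^ (d + 1) / (d + 1)) := by
  rcases ha.eq_or_lt with rfl | ha
  · have : {r : Ioi (0 : ℝ) | (r : ℝ) ≤ 0} = ∅ := by
      ext r
      simpa using mem_Ioi.mp r.2
    simp [this]
  · rw [← Measure.volumeIoiPow_apply_Iio d ⟨a, ha⟩]
    apply measure_congr
    have hnull : Measure.volumeIoiPow d {(⟨a, ha⟩ : Ioi (0 : ℝ))} = 0 := by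
      refine withDensity_absolutelyContinuous _ _ ?_
      rw [comap_subtype_coe_apply measurableSet_Ioi]
      simp
    change (Iic (⟨a, ha⟩ : Ioi (0 : ℝ))) =ᵐ[_] _
    exact (Iio_ae_eq_Iic' hnull).symm

/-- Volume of a part of a star-shaped set in polar coordinates. -/
theorem volume_real_eq_integral_sphere [Nontrivial E] {A : Set E}
    {U : Set (Metric.sphere (0 : E) 1)} {ρ : Metric.sphere (0 : E) 1 → ℝ}
    (hU : MeasurableSet U) (hρ : Measurable ρ) (hρ0 : ∀ θ, 0 ≤ ρ θ)
    (hA : ∀ θ : Metric.sphere (0 : E) 1, ∀ r : ℝ, 0 < r →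
      (r • (θ : E) ∈ A ↔ θ ∈ U ∧ r ≤ ρ θ)) :
    (volume : Measure E).real A = ∫ θ, U.indicator
      (fun θ => ρ θ ^ Module.finrank ℝ E / Module.finrank ℝ E) θ
        ∂(volume : Measure E).toSphere := by
  set d := Module.finrank ℝ E with hd
  have hd0 : 0 < d := Module.finrank_pos
  let B : Set (Metric.sphere (0 : E) 1 × Ioi (0 : ℝ)) := {p | p.1 ∈ U ∧ (p.2 : ℝ) ≤ ρ p.1}
  have hB : MeasurableSet B :=
    (measurable_fst hU).inter
      (measurableSet_le (measurable_subtype_coe.comp measurable_snd) (hρ.comp measurable_fst))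
  -- `B` is `A` without the origin in polar coordinates; the origin is a null set.
  have hpre : (homeomorphUnitSphereProd E) ⁻¹' B = ((↑) : ({0}ᶜ : Set E) → E) ⁻¹' A := by
    ext y
    have := hA (homeomorphUnitSphereProd E y).1 (homeomorphUnitSphereProd E y).2
      (homeomorphUnitSphereProd E y).2.2
    have hy : ((homeomorphUnitSphereProd E y).2 : ℝ) • ((homeomorphUnitSphereProd E y).1 : E)
        = y := by
      have h0 : ‖(y : E)‖ ≠ 0 := norm_ne_zero_iff.mpr y.2
      simp [smul_smul, h0]
    rw [hy] at this
    exact this.symm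
  have h1 : volume A = ((volume : Measure E).toSphere.prod (Measure.volumeIoiPow (d - 1))) B := by
    rw [← (volume : Measure E).measurePreserving_homeomorphUnitSphereProd.measure_preimage
      hB.nullMeasurableSet, hpre, comap_subtype_coe_apply (measurableSet_singleton _).compl,
      Subtype.image_preimage_coe, inter_comm]
    exact (measure_inter_conull (by simp)).symm
  rw [measureReal_def, h1, Measure.prod_apply hB, integral_eq_lintegral_of_nonneg_ae]
  · congr 1
    refine lintegral_congr fun θ => ?_
    by_cases hθ : θ ∈ U
    · have : (Prod.mk θ ⁻¹' B : Set (Ioi (0 : ℝ))) = {r : Ioi (0 : ℝ) | (r : ℝ) ≤ ρ θ} := by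
        ext; simp [B, hθ]
      rw [this, volumeIoiPow_le _ (hρ0 θ), indicator_of_mem hθ, Nat.cast_pred hd0,
        Nat.sub_add_cancel hd0, sub_add_cancel]
    · have : (Prod.mk θ ⁻¹' B : Set (Ioi (0 : ℝ))) = ∅ := by ext; simp [B, hθ]
      simp [this, hθ]
  · refine Eventually.of_forall fun θ => indicator_nonneg (fun θ _ => ?_) θ
    have := hρ0 θ
    positivity
  · exact (((hρ.pow_const d).div_const _).indicator hU).aestronglyMeasurable

end Sphere

/-! ### Existence -/

section Existence

variable {n : ℕ} {K : Set (Euc n)}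

theorem IsStarBody.bddAbove_radial (hK : IsStarBody K) (θ : Sph n) :
    BddAbove {r : ℝ | 0 ≤ r ∧ r • (θ : Euc n) ∈ K} := by
  obtain ⟨R, hR⟩ := hK.isCompact.isBounded.exists_norm_le
  refine ⟨R, fun r hr => ?_⟩
  have := hR _ hr.2
  rwa [norm_smul, norm_eq_of_mem_sphere θ, mul_one, Real.norm_of_nonneg hr.1] at this

theorem radialFun_nonneg (K : Set (Euc n)) (θ : Sph n) : 0 ≤ radialFun K θ :=
  Real.sSup_nonneg fun _ hr => hr.1

/-- Closedness of `K` makes the supremum a maximum; star-shapedness then fills the segment below it.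
-/
theorem IsStarBody.smul_mem_iff (hK : IsStarBody K) (θ : Sph n) {r : ℝ} (hr : 0 < r) :
    r • (θ : Euc n) ∈ K ↔ r ≤ radialFun K θ := by
  refine ⟨fun h => le_csSup (hK.bddAbove_radial θ) ⟨hr.le, h⟩, fun h => ?_⟩
  have hclosed : IsClosed {r : ℝ | 0 ≤ r ∧ r • (θ : Euc n) ∈ K} :=
    isClosed_Ici.inter
      (hK.isCompact.isClosed.preimage (continuous_id.smul continuous_const))
  have hmem := hclosed.csSup_mem ⟨0, le_rfl, by
    simpa using interior_subset hK.zero_mem_interior⟩ (hK.bddAbove_radial θ)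
  have hpos : 0 < radialFun K θ := hr.trans_le h
  have := hK.starConvex.smul_mem hmem.2 (t := r / radialFun K θ) (by positivity)
    ((div_le_one hpos).mpr h)
  change (r / radialFun K θ) • (radialFun K θ • (θ : Euc n)) ∈ K at this
  rwa [smul_smul, div_mul_cancel₀ _ hpos.ne'] at this

theorem continuous_sphereIncl (ξ : Submodule ℝ (Euc n)) : Continuous (sphereIncl ξ) :=
  (continuous_subtype_val.comp continuous_subtype_val).subtype_mk _

theorem isOpen_hemisphere (m : ℕ) (ε : ℝ) : IsOpen (hemisphere m ε) :=
  isOpen_lt continuous_const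
    (continuous_const.mul ((EuclideanSpace.proj (𝕜 := ℝ) (Fin.last m)).continuous.comp
      continuous_subtype_val))

/-- The part of `ρ_K^k` that lives on a hemisphere. -/
def halfRadialPow {m : ℕ} (k : ℕ) (ε : ℝ) (K : Set (Euc (m + 1))) : Sph (m + 1) → ℝ :=
  (hemisphere m ε).indicator fun θ => radialFun K θ ^ k / k

/-- The even extension of `ρ_K^k / (2k)` from a hemisphere. -/
def evenRadialPow {m : ℕ} (k : ℕ) (ε : ℝ) (K : Set (Euc (m + 1))) (θ : Sph (m + 1)) : ℝ :=
  (halfRadialPow k ε K θ + halfRadialPow k ε K (-θ)) / 2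

variable {m k : ℕ} {ε : ℝ} {K : Set (Euc (m + 1))}

theorem measurable_halfRadialPow (hK : IsStarBody K) : Measurable (halfRadialPow k ε K) :=
  ((hK.continuous_radialFun.measurable.pow_const k).div_const _).indicator
    (isOpen_hemisphere m ε).measurableSet

theorem exists_bound_halfRadialPow (hK : IsStarBody K) :
    ∃ C, ∀ θ, ‖halfRadialPow k ε K θ‖ ≤ C := by
  obtain ⟨C, hC⟩ := isCompact_univ.exists_bound_of_continuousOn
    (((hK.continuous_radialFun.pow k).div_const (k : ℝ)).continuousOn (s := univ))
  exact ⟨C, fun θ => (norm_indicator_le_norm_self _ _).trans (hC θ (mem_univ _))⟩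

theorem integrable_halfRadialPow_comp (hK : IsStarBody K) {α : Type*} [MeasurableSpace α]
    {μ : Measure α} [IsFiniteMeasure μ] {f : α → Sph (m + 1)} (hf : Measurable f) :
    Integrable (fun x => halfRadialPow k ε K (f x)) μ := by
  obtain ⟨C, hC⟩ := exists_bound_halfRadialPow (k := k) (ε := ε) hK
  exact Integrable.of_bound
    ((measurable_halfRadialPow hK).comp hf).aestronglyMeasurable C
    (Eventually.of_forall fun x => hC _)

/-- Polar coordinates in `ξ`: for `r > 0` the sign condition on `rθ` depends on `θ` only. -/
theorem halfSectionVolume_eq (hk : 2 ≤ k) (hK : IsStarBody K) (ξ : Grass (m + 1) k) :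
    halfSectionVolume ε K ξ =
      ∫ θ, halfRadialPow k ε K (sphereIncl ξ.1 θ) ∂(volume : Measure ξ.1).toSphere := by
  have : Nontrivial ξ.1 := Module.nontrivial_of_finrank_pos (R := ℝ) (by rw [ξ.2]; omega)
  have hc := continuous_sphereIncl ξ.1
  have h := volume_real_eq_integral_sphere (E := ξ.1)
    (A := {x | (x : Euc (m + 1)) ∈ K ∧ 0 < ε * (x : Euc (m + 1)) (Fin.last m)})
    (U := sphereIncl ξ.1 ⁻¹' hemisphere m ε) (ρ := fun θ => radialFun K (sphereIncl ξ.1 θ))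
    (hc.measurable (isOpen_hemisphere m ε).measurableSet)
    (hK.continuous_radialFun.comp hc).measurable (fun _ => radialFun_nonneg _ _) ?_
  · rw [halfSectionVolume, h, ξ.2]
    rfl
  · intro θ r hr
    have := hK.smul_mem_iff (sphereIncl ξ.1 θ) hr
    change r • ((θ : ξ.1) : Euc (m + 1)) ∈ K ↔ _ at this
    simp only [mem_ofPred_eq, Submodule.coe_smul, this, mem_preimage, hemisphere, sphereIncl,
      PiLp.smul_apply, smul_eq_mul, mul_left_comm ε r, mul_pos_iff_of_pos_left hr]
    exact and_comm

/-- The unit sphere of `ξ` is symmetric, so both summands of `evenRadialPow` have the same integral.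
-/
theorem funk_evenRadialPow (hk : 2 ≤ k) (hK : IsStarBody K) (ξ : Grass (m + 1) k) :
    funk (evenRadialPow k ε K) ξ = halfSectionVolume ε K ξ := by
  have hc := (continuous_sphereIncl ξ.1).measurable
  rw [halfSectionVolume_eq hk hK, funk]
  simp only [evenRadialPow]
  have hneg : (fun θ => halfRadialPow k ε K (-sphereIncl ξ.1 θ)) =
      fun θ => halfRadialPow k ε K (sphereIncl ξ.1 (-θ)) := rfl
  rw [integral_div, integral_add (integrable_halfRadialPow_comp hK hc)
    (integrable_halfRadialPow_comp hK (f := fun θ => -sphereIncl ξ.1 θ)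
      (continuous_sphereIncl ξ.1).neg.measurable), hneg,
    integral_sphere_neg (fun θ => halfRadialPow k ε K (sphereIncl ξ.1 θ))]
  ring

theorem isFunkInverse_evenRadialPow (hk : 2 ≤ k) (hkn : k ≤ m + 1) (hK : IsStarBody K) :
    IsFunkInverse hkn (halfSectionVolume ε K) (evenRadialPow k ε K) where
  even θ := by simp [evenRadialPow, add_comm]
  integrable := by
    have : IsFiniteMeasure (surfaceMeasure (m + 1)) := by unfold surfaceMeasure; infer_instance
    exact ((integrable_halfRadialPow_comp hK measurable_id).add
      (integrable_halfRadialPow_comp hK continuous_neg.measurable)).div_const 2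
  funk_eq := Eventually.of_forall fun ξ => funk_evenRadialPow hk hK ξ

/-- The antipode of `θ` lies outside the hemisphere, so only one summand survives. -/
theorem evenRadialPow_of_mem {θ : Sph (m + 1)} (hθ : θ ∈ hemisphere m ε) :
    evenRadialPow k ε K θ = radialFun K θ ^ k / (2 * k) := by
  have h : -θ ∉ hemisphere m ε := by
    simp only [hemisphere, mem_ofPred_eq] at hθ ⊢
    have : ((-θ : Sph (m + 1)) : Euc (m + 1)) (Fin.last m) =
        -(θ : Euc (m + 1)) (Fin.last m) := by simp
    rw [this]
    linarith
  rw [evenRadialPow, halfRadialPow, indicator_of_mem hθ, indicator_of_notMem h, add_zero,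
    div_div, mul_comm (k : ℝ)]

theorem continuousOn_evenRadialPow (hK : IsStarBody K) :
    ContinuousOn (evenRadialPow k ε K) (hemisphere m ε) :=
  ((hK.continuous_radialFun.pow k).div_const (2 * (k : ℝ))).continuousOn.congr
    fun _ hθ => evenRadialPow_of_mem hθ

end Existence

/-! ### The orthogonal group acting on the sphere -/

section Action

theorem measurableEmbedding_sphereMap {E F : Type*}
    [NormedAddCommGroup E] [InnerProductSpace ℝ E] [FiniteDimensional ℝ E]
    [MeasurableSpace E] [BorelSpace E]
    [NormedAddCommGroup F] [InnerProductSpace ℝ F] [FiniteDimensional ℝ F]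
    [MeasurableSpace F] [BorelSpace F] (L : E ≃ₗᵢ[ℝ] F) :
    MeasurableEmbedding (sphereMap L) := by
  refine ((continuous_sphereMap L).isClosedEmbedding fun θ η h => ?_).measurableEmbedding
  exact Subtype.ext (L.injective (congrArg Subtype.val h))

instance (n : ℕ) : SecondCountableTopology (Euc n →L[ℝ] Euc n) := by
  have : ProperSpace (Euc n →L[ℝ] Euc n) := FiniteDimensional.proper ℝ _
  infer_instance

/-- A right translate of Haar measure is still left invariant, hence a multiple of it; the finite
total mass forces the factor to be 1. -/
theorem isMulRightInvariant_haar {G : Type*} [Group G] [TopologicalSpace G]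
    [IsTopologicalGroup G] [CompactSpace G] [MeasurableSpace G] [BorelSpace G] :
    (Measure.haar : Measure G).IsMulRightInvariant := by
  refine ⟨fun g => ?_⟩
  have h := Measure.isMulInvariant_eq_smul_of_compactSpace
    (Measure.map (· * g) (Measure.haar : Measure G)) Measure.haar
  set c := Measure.haarScalarFactor (Measure.map (· * g) (Measure.haar : Measure G)) Measure.haar
  have hc : (c : ENNReal) * (Measure.haar : Measure G) univ = (Measure.haar : Measure G) univ := by
    have := congrArg (fun μ : Measure G => μ univ) h
    simp only [Measure.map_apply (measurable_mul_const g) MeasurableSet.univ, preimage_univ] at this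
    exact this.symm
  have h1 : (c : ENNReal) = 1 := by
    have h0 : (Measure.haar : Measure G) univ ≠ 0 := isOpen_univ.measure_ne_zero _ univ_nonempty
    have ht : (Measure.haar : Measure G) univ ≠ ⊤ := measure_ne_top _ _
    rw [← ENNReal.mul_left_inj h0 ht, hc, one_mul]
  rw [h, ENNReal.coe_eq_one.mp h1, one_smul]

variable {n : ℕ}

instance : (Measure.haar : Measure (OrthGroup n)).IsMulRightInvariant :=
  isMulRightInvariant_haar

instance : IsFiniteMeasure (surfaceMeasure n) := by
  unfold surfaceMeasure; infer_instance

instance : (surfaceMeasure n).IsOpenPosMeasure := by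
  unfold surfaceMeasure; infer_instance

/-- The action of the orthogonal group on the unit sphere. -/
def act (T : OrthGroup n) (θ : Sph n) : Sph n := sphereMap (Unitary.linearIsometryEquiv T) θ

theorem coe_act (T : OrthGroup n) (θ : Sph n) :
    (act T θ : Euc n) = (T : Euc n →L[ℝ] Euc n) θ := rfl

theorem act_mul (T S : OrthGroup n) (θ : Sph n) : act (T * S) θ = act T (act S θ) := rfl

theorem continuous_act : Continuous fun p : OrthGroup n × Sph n => act p.1 p.2 := by
  refine Continuous.subtype_mk ?_ _
  exact (continuous_subtype_val.comp continuous_fst).clm_apply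
    (continuous_subtype_val.comp continuous_snd)

theorem continuous_act_left (θ : Sph n) : Continuous fun T : OrthGroup n => act T θ :=
  continuous_act.comp (continuous_id.prodMk continuous_const)

theorem orth_inner (T : OrthGroup n) (x y : Euc n) :
    inner ℝ ((T : Euc n →L[ℝ] Euc n) x) ((T : Euc n →L[ℝ] Euc n) y) = inner ℝ x y :=
  (Unitary.linearIsometryEquiv T).inner_map_map x y

theorem orth_norm (T : OrthGroup n) (x : Euc n) : ‖(T : Euc n →L[ℝ] Euc n) x‖ = ‖x‖ :=
  (Unitary.linearIsometryEquiv T).norm_map x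

theorem orth_mul_apply (T S : OrthGroup n) (x : Euc n) :
    ((T * S : OrthGroup n) : Euc n →L[ℝ] Euc n) x =
      (T : Euc n →L[ℝ] Euc n) ((S : Euc n →L[ℝ] Euc n) x) := rfl

theorem orth_inv_apply_apply (T : OrthGroup n) (x : Euc n) :
    ((T⁻¹ : OrthGroup n) : Euc n →L[ℝ] Euc n) ((T : Euc n →L[ℝ] Euc n) x) = x := by
  rw [← orth_mul_apply, inv_mul_cancel]
  rfl

theorem orth_apply_inv_apply (T : OrthGroup n) (x : Euc n) :
    (T : Euc n →L[ℝ] Euc n) (((T⁻¹ : OrthGroup n) : Euc n →L[ℝ] Euc n) x) = x := by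
  rw [← orth_mul_apply, mul_inv_cancel]
  rfl

theorem orth_inner_inv (T : OrthGroup n) (x y : Euc n) :
    inner ℝ (((T⁻¹ : OrthGroup n) : Euc n →L[ℝ] Euc n) x) y =
      inner ℝ x ((T : Euc n →L[ℝ] Euc n) y) := by
  rw [← orth_inner T, orth_apply_inv_apply]

/-- Vectors of equal norm are exchanged by a reflection. -/
theorem exists_reflection {v w : Euc n} (h : ‖v‖ = ‖w‖) :
    ∃ S : OrthGroup n, (S : Euc n →L[ℝ] Euc n) v = w ∧
      (∀ u : Euc n, inner ℝ (v - w) u = 0 → (S : Euc n →L[ℝ] Euc n) u = u) ∧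
      ∀ u : Euc n, (S : Euc n →L[ℝ] Euc n) u - u ∈ Submodule.span ℝ {v - w} := by
  -- The reflection in the hyperplane orthogonal to `v - w`; it displaces every vector along `v -
  -- w`.
  refine ⟨Unitary.linearIsometryEquiv.symm ((Submodule.span ℝ {v - w})ᗮ.reflection), ?_, ?_, ?_⟩
  · exact Submodule.reflection_sub h
  · intro u hu
    exact Submodule.reflection_mem_subspace_eq_self
      (Submodule.mem_orthogonal_singleton_iff_inner_right.mpr hu)
  · intro u
    change (Submodule.span ℝ {v - w})ᗮ.reflection u - u ∈ _
    rw [Submodule.reflection_orthogonal_apply, Submodule.reflection_apply]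
    have : -((2 : ℕ) • (Submodule.span ℝ {v - w}).starProjection u - u) - u =
        (-2 : ℝ) • (Submodule.span ℝ {v - w}).starProjection u := by module
    rw [this]
    exact Submodule.smul_mem _ _ (Submodule.starProjection_apply_mem _ _)

theorem exists_act_eq (θ η : Sph n) : ∃ S : OrthGroup n, act S θ = η := by
  obtain ⟨S, hS, -⟩ := exists_reflection (v := (θ : Euc n)) (w := η) (by simp)
  exact ⟨S, Subtype.ext hS⟩

/-- By transitivity and right invariance, the Haar measure of `{T | Tθ ∈ s}` does not depend on `θ`.
Computing the product measure of `{(T, θ) | Tθ ∈ s}` in both orders gives the constant. -/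
theorem map_act_haar (θ₀ : Sph n) :
    (Measure.haar : Measure (OrthGroup n)).map (fun T => act T θ₀) =
      ((Measure.haar : Measure (OrthGroup n)) univ / surfaceMeasure n univ) •
        surfaceMeasure n := by
  ext s hs
  have hindep : ∀ θ : Sph n, (Measure.haar : Measure (OrthGroup n)) {T | act T θ ∈ s} =
      Measure.haar {T : OrthGroup n | act T θ₀ ∈ s} := by
    intro θ
    obtain ⟨S, hS⟩ := exists_act_eq θ θ₀
    rw [← measure_preimage_mul_right Measure.haar S {T : OrthGroup n | act T θ ∈ s}]
    simp only [preimage_ofPred_eq, act_mul, hS]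
  have hm : MeasurableSet {p : OrthGroup n × Sph n | act p.1 p.2 ∈ s} :=
    continuous_act.measurable hs
  have h1 := Measure.prod_apply (μ := (Measure.haar : Measure (OrthGroup n)))
    (ν := surfaceMeasure n) hm
  rw [Measure.prod_apply_symm hm] at h1
  have h2 : ∀ T : OrthGroup n,
      surfaceMeasure n (Prod.mk T ⁻¹' {p : OrthGroup n × Sph n | act p.1 p.2 ∈ s}) =
        surfaceMeasure n s := fun T =>
    (measurePreserving_sphereMap (Unitary.linearIsometryEquiv T)).measure_preimage
      hs.nullMeasurableSet
  have h3 : ∀ θ : Sph n, (Measure.haar : Measure (OrthGroup n))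
      ((fun T => (T, θ)) ⁻¹' {p : OrthGroup n × Sph n | act p.1 p.2 ∈ s}) =
        Measure.haar {T : OrthGroup n | act T θ₀ ∈ s} := hindep
  simp only [h2, h3, lintegral_const] at h1
  have h0 : surfaceMeasure n univ ≠ 0 := isOpen_univ.measure_ne_zero _ ⟨θ₀, trivial⟩
  rw [Measure.map_apply (continuous_act_left θ₀).measurable hs, Measure.smul_apply, smul_eq_mul,
    ENNReal.div_eq_inv_mul, mul_assoc, mul_comm _ (surfaceMeasure n s), ← h1, mul_comm _⁻¹,
    mul_assoc, ENNReal.mul_inv_cancel h0 (measure_ne_top _ _), mul_one]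
  rfl

theorem haar_div_ne_top (θ₀ : Sph n) :
    (Measure.haar : Measure (OrthGroup n)) univ / surfaceMeasure n univ ≠ ⊤ :=
  (ENNReal.div_lt_top (measure_ne_top _ _)
    (isOpen_univ.measure_ne_zero _ ⟨θ₀, trivial⟩)).ne

theorem integral_act_haar {f : Sph n → ℝ} (hf : AEStronglyMeasurable f (surfaceMeasure n))
    (θ₀ : Sph n) :
    ∫ T : OrthGroup n, f (act T θ₀) ∂Measure.haar =
      ((Measure.haar : Measure (OrthGroup n)) univ / surfaceMeasure n univ).toReal *
        ∫ θ, f θ ∂surfaceMeasure n := by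
  rw [← smul_eq_mul, ← integral_smul_measure, ← map_act_haar θ₀, integral_map
    (continuous_act_left θ₀).measurable.aemeasurable]
  rw [map_act_haar]
  exact hf.smul_measure _

theorem integral_sphere_eq_zero {f : Sph n → ℝ}
    (hf : AEStronglyMeasurable f (surfaceMeasure n)) (θ₀ : Sph n)
    (h : ∫ T : OrthGroup n, f (act T θ₀) ∂Measure.haar = 0) :
    ∫ θ, f θ ∂surfaceMeasure n = 0 := by
  rw [integral_act_haar hf] at h
  refine (mul_eq_zero.mp h).resolve_left ?_
  refine ENNReal.toReal_ne_zero.mpr ⟨?_, haar_div_ne_top θ₀⟩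
  exact ENNReal.div_ne_zero.mpr ⟨isOpen_univ.measure_ne_zero _ univ_nonempty, measure_ne_top _ _⟩

/-- The points `Tθ`, with `T` and `θ ∈ ξ` random, are uniformly distributed on the sphere. -/
theorem map_act_prod (ξ : Submodule ℝ (Euc n)) :
    ((Measure.haar : Measure (OrthGroup n)).prod (volume : Measure ξ).toSphere).map
        (fun p => act p.1 (sphereIncl ξ p.2)) =
      (((Measure.haar : Measure (OrthGroup n)) univ / surfaceMeasure n univ) *
        (volume : Measure ξ).toSphere univ) • surfaceMeasure n := by
  ext s hs
  have hc : Continuous fun p : OrthGroup n × Metric.sphere (0 : ξ) 1 =>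
      act p.1 (sphereIncl ξ p.2) :=
    continuous_act.comp
      (continuous_fst.prodMk ((continuous_sphereIncl ξ).comp continuous_snd))
  rw [Measure.map_apply hc.measurable hs, Measure.prod_apply_symm (hc.measurable hs)]
  have h3 : ∀ θ, (Measure.haar : Measure (OrthGroup n))
      ((fun T => (T, θ)) ⁻¹' ((fun p : OrthGroup n × Metric.sphere (0 : ξ) 1 =>
        act p.1 (sphereIncl ξ p.2)) ⁻¹' s)) =
      ((Measure.haar : Measure (OrthGroup n)) univ / surfaceMeasure n univ) *
        surfaceMeasure n s := by
    intro θ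
    have := congrArg (fun μ : Measure (Sph n) => μ s) (map_act_haar (sphereIncl ξ θ))
    simp only [Measure.map_apply (continuous_act_left _).measurable hs] at this
    exact this
  simp only [h3, lintegral_const, Measure.smul_apply, smul_eq_mul]
  ring

/-- With Fubini, this makes `g` integrable over almost every rotated section. The point `θ₀` shows
that the sphere is nonempty, so that the factor in `map_act_prod` is finite. -/
theorem integrable_act_prod (ξ : Submodule ℝ (Euc n)) {g : Sph n → ℝ}
    (hg : Integrable g (surfaceMeasure n)) (θ₀ : Sph n) :
    Integrable (fun p : OrthGroup n × Metric.sphere (0 : ξ) 1 => g (act p.1 (sphereIncl ξ p.2)))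
      ((Measure.haar : Measure (OrthGroup n)).prod (volume : Measure ξ).toSphere) := by
  have hc : Continuous fun p : OrthGroup n × Metric.sphere (0 : ξ) 1 =>
      act p.1 (sphereIncl ξ p.2) :=
    continuous_act.comp
      (continuous_fst.prodMk ((continuous_sphereIncl ξ).comp continuous_snd))
  have h := hg.smul_measure (c := ((Measure.haar : Measure (OrthGroup n)) univ /
    surfaceMeasure n univ) * (volume : Measure ξ).toSphere univ)
    (ENNReal.mul_ne_top (haar_div_ne_top θ₀) (measure_ne_top _ _))
  rw [← map_act_prod] at h
  exact h.comp_measurable hc.measurable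

theorem integrable_act_haar {g : Sph n → ℝ} (hg : Integrable g (surfaceMeasure n)) (θ₀ : Sph n) :
    Integrable (fun T : OrthGroup n => g (act T θ₀)) Measure.haar := by
  have h := hg.smul_measure (haar_div_ne_top θ₀)
  rw [← map_act_haar θ₀] at h
  exact h.comp_measurable (continuous_act_left θ₀).measurable

/-- The Funk transform at a rotated subspace. -/
theorem funk_rotate {k : ℕ} (g : Sph n → ℝ) (T : OrthGroup n) (ξ : Grass n k) :
    funk g (rotate T ξ) =
      ∫ θ, g (act T (sphereIncl ξ.1 θ)) ∂(volume : Measure ξ.1).toSphere := by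
  let L : ξ.1 ≃ₗᵢ[ℝ] (rotate T ξ).1 :=
    LinearIsometryEquiv.submoduleMap ξ.1 (Unitary.linearIsometryEquiv T)
  exact ((measurePreserving_sphereMap L).integral_comp (measurableEmbedding_sphereMap L)
    (fun θ => g (sphereIncl _ θ))).symm

end Action

/-! ### Injectivity of the Funk transform on even functions. -/

section Injectivity

variable {n : ℕ}

theorem continuous_projection_pow (W : Submodule ℝ (Euc n)) (x : Euc n) (j : ℕ) :
    Continuous fun T : OrthGroup n =>
      ‖Wᗮ.starProjection (((T⁻¹ : OrthGroup n) : Euc n →L[ℝ] Euc n) x)‖ ^ j :=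
  ((Wᗮ.starProjection.continuous.comp
    ((continuous_subtype_val.comp continuous_inv).clm_apply continuous_const)).norm).pow j

theorem exists_bound_of_continuous {G : Type*} [TopologicalSpace G] [CompactSpace G] {f : G → ℝ}
    (hf : Continuous f) : ∃ C, ∀ T, ‖f T‖ ≤ C := by
  obtain ⟨C, hC⟩ := isCompact_univ.exists_bound_of_continuousOn (hf.continuousOn (s := univ))
  exact ⟨C, fun T => hC T (mem_univ _)⟩

/-- If the integrals of `d` over the sections by almost all rotations of `W` vanish, then so do the
averages of `d(Tθ₀)` against functions of the distance of a point to the rotated subspace. -/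
theorem integral_mul_projection_pow_eq_zero {W : Submodule ℝ (Euc n)} {d : Sph n → ℝ}
    (hd : Integrable d (surfaceMeasure n))
    (h : ∀ᵐ T : OrthGroup n ∂Measure.haar,
      ∫ θ, d (act T (sphereIncl W θ)) ∂(volume : Measure W).toSphere = 0)
    (θ₀ : Metric.sphere (0 : W) 1) (x : Euc n) (j : ℕ) :
    ∫ T : OrthGroup n, d (act T (sphereIncl W θ₀)) *
      ‖Wᗮ.starProjection (((T⁻¹ : OrthGroup n) : Euc n →L[ℝ] Euc n) x)‖ ^ j ∂Measure.haar = 0 := by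
  -- `a T` is the `j`-th power of the distance from `x` to `TW`.
  set a : OrthGroup n → ℝ := fun T =>
    ‖Wᗮ.starProjection (((T⁻¹ : OrthGroup n) : Euc n →L[ℝ] Euc n) x)‖ ^ j with ha
  have hac : Continuous a := continuous_projection_pow W x j
  have hindep : ∀ θ : Metric.sphere (0 : W) 1,
      ∫ T : OrthGroup n, d (act T (sphereIncl W θ)) * a T ∂Measure.haar =
        ∫ T : OrthGroup n, d (act T (sphereIncl W θ₀)) * a T ∂Measure.haar := by
    intro θ
    -- `S` takes `θ₀` to `θ` and displaces vectors only within `W`, so it leaves projections to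
    -- `Wᗮ`, hence `a`, unchanged; substitute `T ↦ TS`.
    obtain ⟨S, hS, -, hspan⟩ := exists_reflection
      (v := (sphereIncl W θ₀ : Euc n)) (w := sphereIncl W θ) (by simp)
    have hSW : ∀ u : Euc n, Wᗮ.starProjection ((S : Euc n →L[ℝ] Euc n) u) =
        Wᗮ.starProjection u := by
      intro u
      rw [← sub_eq_zero, ← map_sub]
      refine Submodule.starProjection_orthogonal_apply_eq_zero ?_
      refine (Submodule.span_le.mpr ?_) (hspan u)
      rw [singleton_subset_iff]
      exact W.sub_mem θ₀.1.2 θ.1.2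
    have hSa : ∀ T : OrthGroup n, a (T * S) = a T := by
      intro T
      simp only [ha]
      rw [← hSW (((T * S)⁻¹ : OrthGroup n).1 x), ← orth_mul_apply]
      simp
    have hact : act S (sphereIncl W θ₀) = sphereIncl W θ := Subtype.ext hS
    rw [← integral_mul_right_eq_self (fun T => d (act T (sphereIncl W θ₀)) * a T) S]
    simp only [hSa, act_mul, hact]
  have hint : Integrable (fun p : OrthGroup n × Metric.sphere (0 : W) 1 =>
      d (act p.1 (sphereIncl W p.2)) * a p.1)
      ((Measure.haar : Measure (OrthGroup n)).prod (volume : Measure W).toSphere) := by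
    obtain ⟨C, hC⟩ := exists_bound_of_continuous hac
    exact (integrable_act_prod W hd (sphereIncl W θ₀)).mul_bdd
      (hac.comp continuous_fst).aestronglyMeasurable (Eventually.of_forall fun p => hC p.1)
  -- Integrating over `θ` first gives zero; integrating over `T` first gives the wanted integral
  -- times the mass of the sphere of `W`.
  have hswap := integral_integral_swap (f := fun (T : OrthGroup n) θ =>
    d (act T (sphereIncl W θ)) * a T) hint
  simp only [hindep, integral_const, integral_mul_const] at hswap
  have h0 : ∫ T : OrthGroup n, (∫ θ, d (act T (sphereIncl W θ))
      ∂(volume : Measure W).toSphere) * a T ∂Measure.haar = 0 := by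
    refine integral_eq_zero_of_ae ?_
    filter_upwards [h] with T hT
    simp [hT]
  rw [h0, eq_comm, smul_eq_mul] at hswap
  refine (mul_eq_zero.mp hswap).resolve_left ?_
  rw [measureReal_def]
  exact ENNReal.toReal_ne_zero.mpr
    ⟨isOpen_univ.measure_ne_zero _ ⟨θ₀, trivial⟩, measure_ne_top _ _⟩

/-- The stabilizer of a vector in the orthogonal group. -/
def stabilizer (v : Euc n) : Subgroup (OrthGroup n) where
  carrier := {T | (T : Euc n →L[ℝ] Euc n) v = v}
  one_mem' := rfl
  mul_mem' {T S} hT hS := by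
    change ((T * S : OrthGroup n) : Euc n →L[ℝ] Euc n) v = v
    rw [orth_mul_apply, hS, hT]
  inv_mem' {T} hT := by
    change ((T⁻¹ : OrthGroup n) : Euc n →L[ℝ] Euc n) v = v
    nth_rewrite 1 [← show (T : Euc n →L[ℝ] Euc n) v = v from hT]
    exact orth_inv_apply_apply T v

instance (v : Euc n) : CompactSpace (stabilizer v) := by
  refine isCompact_iff_compactSpace.mp (IsClosed.isCompact ?_)
  exact isClosed_eq (continuous_subtype_val.clm_apply continuous_const) continuous_const

/-- Averaging over the stabilizer of `v`: the mean of a power of the norm of the projection. -/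
theorem exists_integral_stabilizer {W : Submodule ℝ (Euc n)} (hW : W ≠ ⊤) {v : Euc n}
    (hv : v ∈ W) (hv1 : ‖v‖ = 1) (j : ℕ) :
    ∃ c : ℝ, 0 < c ∧ ∀ y : Euc n,
      ∫ R : stabilizer v, ‖Wᗮ.starProjection
        ((((R⁻¹ : stabilizer v) : OrthGroup n) : Euc n →L[ℝ] Euc n) y)‖ ^ (2 * j)
          ∂Measure.haar = c * (‖y‖ ^ 2 - inner ℝ y v ^ 2) ^ j := by
  set Φ : Euc n → ℝ := fun y => ∫ R : stabilizer v, ‖Wᗮ.starProjection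
        ((((R⁻¹ : stabilizer v) : OrthGroup n) : Euc n →L[ℝ] Euc n) y)‖ ^ (2 * j)
          ∂Measure.haar with hΦ
  -- The constant is the average at a unit vector `u ∈ Wᗮ`; it is positive because the integrand is
  -- 1 at the identity.
  obtain ⟨u', hu', hu'0⟩ := (Submodule.ne_bot_iff _).mp
    (fun h => hW ((Submodule.orthogonal_eq_bot_iff).mp h) : Wᗮ ≠ ⊥)
  set u : Euc n := ‖u'‖⁻¹ • u' with hu
  have huW : u ∈ Wᗮ := Submodule.smul_mem _ _ hu'
  have hu1 : ‖u‖ = 1 := by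
    rw [hu, norm_smul, norm_inv, norm_norm, inv_mul_cancel₀ (norm_ne_zero_iff.mpr hu'0)]
  have hvu : inner ℝ v u = 0 := (Submodule.mem_orthogonal _ _).mp huW v hv
  refine ⟨Φ u, ?_, fun y => ?_⟩
  · have hcont : Continuous fun R : stabilizer v => ‖Wᗮ.starProjection
        ((((R⁻¹ : stabilizer v) : OrthGroup n) : Euc n →L[ℝ] Euc n) u)‖ ^ (2 * j) :=
      (continuous_projection_pow W u (2 * j)).comp continuous_subtype_val
    refine hcont.integral_pos_of_hasCompactSupport_nonneg_nonzero
      (HasCompactSupport.of_compactSpace _) (fun R => by positivity) (x := 1) ?_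
    have : Wᗮ.starProjection u = u := Submodule.starProjection_eq_self_iff.mpr huW
    simp [this, hu1]
  -- The component of `y` along `v` is fixed by the stabilizer and killed by the projection, so only
  -- `w ⟂ v` matters.
  · set w : Euc n := y - inner ℝ y v • v with hw
    have hvw : inner ℝ w v = 0 := by
      rw [hw, inner_sub_left, inner_smul_left, real_inner_self_eq_norm_sq, hv1]
      simp
    have hwn : ‖w‖ ^ 2 = ‖y‖ ^ 2 - inner ℝ y v ^ 2 := by
      rw [hw, norm_sub_sq_real, inner_smul_right, norm_smul, hv1, mul_one, Real.norm_eq_abs,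
        sq_abs]
      ring
    have hyw : Φ y = Φ w := by
      refine integral_congr_ae (Eventually.of_forall fun R => ?_)
      have hR : (((R⁻¹ : stabilizer v) : OrthGroup n) : Euc n →L[ℝ] Euc n) v = v := (R⁻¹).2
      simp only [hw, map_sub, map_smul, hR]
      rw [Submodule.starProjection_orthogonal_apply_eq_zero hv, smul_zero, sub_zero]
    have hnorm : ‖‖w‖ • u‖ = ‖w‖ := by rw [norm_smul, norm_norm, hu1, mul_one]
    -- Both `w` and `‖w‖ • u` are orthogonal to `v`, so this reflection lies in the stabilizer.
    obtain ⟨S, hS, hSfix, -⟩ := exists_reflection hnorm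
    have hSv : S ∈ stabilizer v := by
      refine hSfix v ?_
      rw [inner_sub_left, inner_smul_left, real_inner_comm, hvu, hvw]
      simp
    have hwu : Φ w = Φ (‖w‖ • u) := by
      simp only [hΦ]
      rw [← integral_mul_left_eq_self _ (⟨S, hSv⟩ : stabilizer v)]
      refine integral_congr_ae (Eventually.of_forall fun R => ?_)
      simp only [mul_inv_rev]
      congr 2
      change Wᗮ.starProjection (((R⁻¹ : stabilizer v) : OrthGroup n).1 ((S⁻¹ : OrthGroup n).1 w)) =
        _
      have hSw : (S⁻¹ : OrthGroup n).1 w = ‖w‖ • u :=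
        (congrArg _ hS.symm).trans (orth_inv_apply_apply S _)
      rw [hSw]
    have hscale : Φ (‖w‖ • u) = Φ u * ‖w‖ ^ (2 * j) := by
      simp only [hΦ, map_smul, norm_smul, norm_norm, mul_pow]
      rw [integral_const_mul, mul_comm]
    change Φ y = _
    rw [hyw, hwu, hscale, pow_mul, hwn]

/-- Replacing `T` by `TR`, with `R` fixing `v`, keeps `Tv`. Averaging over `R` turns the distance
weight into a function of `Tv` alone, and `Tv` is uniformly distributed on the sphere. -/
theorem integral_mul_pow_eq_zero {W : Submodule ℝ (Euc n)} (hW : W ≠ ⊤) {d : Sph n → ℝ}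
    (hd : Integrable d (surfaceMeasure n))
    (h : ∀ᵐ T : OrthGroup n ∂Measure.haar,
      ∫ θ, d (act T (sphereIncl W θ)) ∂(volume : Measure W).toSphere = 0)
    (θ₀ : Metric.sphere (0 : W) 1) (x : Euc n) (j : ℕ) :
    ∫ θ, d θ * (‖x‖ ^ 2 - inner ℝ x (θ : Euc n) ^ 2) ^ j ∂surfaceMeasure n = 0 := by
  set v : Sph n := sphereIncl W θ₀ with hv
  obtain ⟨c, hc, hcy⟩ := exists_integral_stabilizer hW (v := (v : Euc n)) θ₀.1.2 (by simp) j
  refine integral_sphere_eq_zero ?_ v ?_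
  · refine hd.aestronglyMeasurable.mul (Continuous.aestronglyMeasurable ?_)
    exact (continuous_const.sub
      ((continuous_const.inner continuous_subtype_val).pow 2)).pow j
  set a : OrthGroup n → ℝ := fun T =>
    ‖Wᗮ.starProjection (((T⁻¹ : OrthGroup n) : Euc n →L[ℝ] Euc n) x)‖ ^ (2 * j) with ha
  have hac : Continuous a := continuous_projection_pow W x (2 * j)
  have h0 : ∀ R : stabilizer (v : Euc n),
      ∫ T : OrthGroup n, d (act T v) * a (T * R) ∂Measure.haar = 0 := by
    intro R
    have hR : act (R : OrthGroup n) v = v := Subtype.ext R.2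
    have := integral_mul_projection_pow_eq_zero hd h θ₀ x (2 * j)
    rw [← integral_mul_right_eq_self _ (R : OrthGroup n)] at this
    simpa only [act_mul, ← hv, hR] using this
  have hint : Integrable (fun p : stabilizer (v : Euc n) × OrthGroup n =>
      d (act p.2 v) * a (p.2 * p.1))
      ((Measure.haar : Measure (stabilizer (v : Euc n))).prod Measure.haar) := by
    obtain ⟨C, hC⟩ := exists_bound_of_continuous hac
    refine ((integrable_act_haar hd v).comp_snd _).mul_bdd
      (hac.comp (continuous_snd.mul
        (continuous_subtype_val.comp continuous_fst))).aestronglyMeasurable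
      (Eventually.of_forall fun p => hC _)
  have hswap := integral_integral_swap
    (f := fun (R : stabilizer (v : Euc n)) (T : OrthGroup n) => d (act T v) * a (T * R)) hint
  simp only [h0, integral_zero, integral_const_mul] at hswap
  have havg : ∀ T : OrthGroup n, ∫ R : stabilizer (v : Euc n), a (T * R) ∂Measure.haar =
      c * (‖x‖ ^ 2 - inner ℝ x (act T v : Euc n) ^ 2) ^ j := by
    intro T
    have := hcy (((T⁻¹ : OrthGroup n) : Euc n →L[ℝ] Euc n) x)
    rw [orth_norm, orth_inner_inv] at this
    rw [coe_act, ← this]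
    refine integral_congr_ae (Eventually.of_forall fun R => ?_)
    simp only [ha, mul_inv_rev]
    rfl
  simp only [havg, mul_left_comm _ c, integral_const_mul] at hswap
  exact (mul_eq_zero.mp hswap.symm).resolve_left hc.ne'

/-- By linearity `d` annihilates every polynomial in `s = ‖x‖² - ⟨x,θ⟩²`; take `(‖x‖² - s)^j`. -/
theorem integral_mul_inner_pow_eq_zero {d : Sph n → ℝ} (hd : Integrable d (surfaceMeasure n))
    (x : Euc n)
    (h : ∀ j : ℕ, ∫ θ, d θ * (‖x‖ ^ 2 - inner ℝ x (θ : Euc n) ^ 2) ^ j ∂surfaceMeasure n = 0)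
    (j : ℕ) :
    ∫ θ, d θ * inner ℝ x (θ : Euc n) ^ (2 * j) ∂surfaceMeasure n = 0 := by
  have hcont : Continuous fun θ : Sph n => ‖x‖ ^ 2 - inner ℝ x (θ : Euc n) ^ 2 :=
    continuous_const.sub ((continuous_const.inner continuous_subtype_val).pow 2)
  have hint : ∀ p : Polynomial ℝ, Integrable
      (fun θ : Sph n => d θ * p.eval (‖x‖ ^ 2 - inner ℝ x (θ : Euc n) ^ 2))
      (surfaceMeasure n) := by
    intro p
    have hc := p.continuous.comp hcont
    obtain ⟨C, hC⟩ := exists_bound_of_continuous hc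
    exact hd.mul_bdd hc.aestronglyMeasurable (Eventually.of_forall hC)
  have hpoly : ∀ p : Polynomial ℝ,
      ∫ θ, d θ * p.eval (‖x‖ ^ 2 - inner ℝ x (θ : Euc n) ^ 2) ∂surfaceMeasure n = 0 := by
    intro p
    induction p using Polynomial.induction_on' with
    | add p q hp hq =>
      simp only [Polynomial.eval_add, mul_add]
      rw [integral_add (hint p) (hint q), hp, hq, add_zero]
    | monomial i a =>
      simp only [Polynomial.eval_monomial, mul_left_comm _ a]
      rw [integral_const_mul, h, mul_zero]
  have := hpoly ((Polynomial.C (‖x‖ ^ 2) - Polynomial.X) ^ j)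
  simpa [pow_mul] using this

/-- The cosine series has only even powers and is dominated by `|d|` times the series of `cosh ‖x‖`.
-/
theorem integral_mul_cos_eq_zero {d : Sph n → ℝ} (hd : Integrable d (surfaceMeasure n))
    (x : Euc n)
    (h : ∀ j : ℕ, ∫ θ, d θ * inner ℝ x (θ : Euc n) ^ (2 * j) ∂surfaceMeasure n = 0) :
    ∫ θ, d θ * Real.cos (inner ℝ x (θ : Euc n)) ∂surfaceMeasure n = 0 := by
  have hsum : HasSum (fun j : ℕ => ∫ θ, d θ *
      ((-1) ^ j * inner ℝ x (θ : Euc n) ^ (2 * j) / (2 * j).factorial) ∂surfaceMeasure n)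
      (∫ θ, d θ * Real.cos (inner ℝ x (θ : Euc n)) ∂surfaceMeasure n) := by
    refine hasSum_integral_of_dominated_convergence
      (fun j θ => |d θ| * (‖x‖ ^ (2 * j) / (2 * j).factorial)) (fun j => ?_) (fun j => ?_) ?_ ?_ ?_
    · refine hd.aestronglyMeasurable.mul (Continuous.aestronglyMeasurable ?_)
      exact (continuous_const.mul
        ((continuous_const.inner continuous_subtype_val).pow _)).div_const _
    · refine Eventually.of_forall fun θ => ?_
      have hθ : |inner ℝ x (θ : Euc n)| ≤ ‖x‖ := by
        simpa using abs_real_inner_le_norm x (θ : Euc n)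
      rw [norm_mul, Real.norm_eq_abs, norm_div, norm_mul, norm_pow, norm_neg, norm_one, one_pow,
        one_mul, norm_pow, Real.norm_eq_abs, RCLike.norm_natCast]
      gcongr
    · exact Eventually.of_forall fun θ => (Real.hasSum_cosh ‖x‖).summable.mul_left _
    · simp only [tsum_mul_left]
      exact hd.abs.mul_const _
    · exact Eventually.of_forall fun θ => (Real.hasSum_cos _).mul_left _
  have hz : (fun j : ℕ => ∫ θ, d θ *
      ((-1) ^ j * inner ℝ x (θ : Euc n) ^ (2 * j) / (2 * j).factorial) ∂surfaceMeasure n) =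
      fun _ => 0 := by
    funext j
    have : ∀ θ : Sph n, d θ *
        ((-1) ^ j * inner ℝ x (θ : Euc n) ^ (2 * j) / (2 * j).factorial) =
        ((-1) ^ j / (2 * j).factorial) * (d θ * inner ℝ x (θ : Euc n) ^ (2 * j)) := by
      intro θ; ring
    simp only [this, integral_const_mul, h, mul_zero]
  rw [hz] at hsum
  exact hsum.unique hasSum_zero

theorem integral_mul_sin_eq_zero {d : Sph n → ℝ} (heven : ∀ θ, d (-θ) = d θ) (x : Euc n) :
    ∫ θ, d θ * Real.sin (inner ℝ x (θ : Euc n)) ∂surfaceMeasure n = 0 := by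
  have h := integral_sphere_neg (fun θ : Sph n => d θ * Real.sin (inner ℝ x (θ : Euc n)))
  have hneg : ∀ θ : Sph n, d (-θ) * Real.sin (inner ℝ x ((-θ : Sph n) : Euc n)) =
      -(d θ * Real.sin (inner ℝ x (θ : Euc n))) := by
    intro θ
    have : ((-θ : Sph n) : Euc n) = -(θ : Euc n) := by simp
    rw [heven, this, inner_neg_right, Real.sin_neg, mul_neg]
  simp only [hneg, integral_neg] at h
  change ∫ θ, d θ * Real.sin (inner ℝ x (θ : Euc n)) ∂(volume : Measure (Euc n)).toSphere = 0
  linarith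

/-- A function on the sphere with vanishing Fourier transform vanishes. -/
theorem ae_eq_zero_of_fourier {d : Sph n → ℝ} (hd : Integrable d (surfaceMeasure n))
    (hcos : ∀ x : Euc n, ∫ θ, d θ * Real.cos (inner ℝ x (θ : Euc n)) ∂surfaceMeasure n = 0)
    (hsin : ∀ x : Euc n, ∫ θ, d θ * Real.sin (inner ℝ x (θ : Euc n)) ∂surfaceMeasure n = 0) :
    d =ᵐ[surfaceMeasure n] 0 := by
  set σ := surfaceMeasure n
  have hemb : MeasurableEmbedding ((↑) : Sph n → Euc n) :=
    MeasurableEmbedding.subtype_coe Metric.isClosed_sphere.measurableSet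
  have hfin : ∀ f : Sph n → ℝ, Integrable f σ →
      IsFiniteMeasure (σ.withDensity fun θ => ENNReal.ofReal (f θ)) := fun f hf =>
    isFiniteMeasure_withDensity_ofReal hf.2
  have := hfin d hd
  have := hfin _ hd.neg
  have hbd : ∀ x : Euc n, ∀ f : Sph n → ℝ, Integrable f σ → Integrable (fun θ : Sph n =>
      (f θ : ℂ) * Complex.exp (inner ℝ (θ : Euc n) x * Complex.I)) σ := by
    intro x f hf
    refine hf.ofReal.mul_bdd (c := 1) (Continuous.aestronglyMeasurable ?_)
      (Eventually.of_forall fun θ => (Complex.norm_exp_ofReal_mul_I _).le)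
    exact Complex.continuous_exp.comp ((Complex.continuous_ofReal.comp
      (continuous_subtype_val.inner continuous_const)).mul continuous_const)
  have hchar : ∀ f : Sph n → ℝ, Integrable f σ → ∀ x : Euc n,
      charFun ((σ.withDensity fun θ => ENNReal.ofReal (f θ)).map ((↑) : Sph n → Euc n)) x =
        ∫ θ, ((max (f θ) 0 : ℝ) : ℂ) * Complex.exp (inner ℝ (θ : Euc n) x * Complex.I) ∂σ := by
    intro f hf x
    rw [charFun_apply, hemb.integral_map, integral_withDensity_eq_integral_toReal_smul₀
      hf.aemeasurable.ennreal_ofReal (Eventually.of_forall fun _ => ENNReal.ofReal_lt_top)]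
    refine integral_congr_ae (Eventually.of_forall fun θ => ?_)
    simp only [ENNReal.toReal_ofReal', Complex.real_smul]
  -- `ENNReal.ofReal` truncates at zero, so these are the finite measures with densities `d⁺` and
  -- `d⁻`. Their characteristic functions differ by the Fourier integral of `d`, which is zero.
  have heq : (σ.withDensity fun θ => ENNReal.ofReal (d θ)).map ((↑) : Sph n → Euc n) =
      (σ.withDensity fun θ => ENNReal.ofReal ((-d) θ)).map ((↑) : Sph n → Euc n) := by
    have := Measure.isFiniteMeasure_map (σ.withDensity fun θ => ENNReal.ofReal (d θ))
      ((↑) : Sph n → Euc n)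
    have := Measure.isFiniteMeasure_map (σ.withDensity fun θ => ENNReal.ofReal ((-d) θ))
      ((↑) : Sph n → Euc n)
    refine Measure.ext_of_charFun (funext fun x => ?_)
    rw [hchar d hd, hchar _ hd.neg, ← sub_eq_zero, ← integral_sub (hbd x _ hd.pos_part)
      (hbd x _ hd.neg.pos_part)]
    have hpt : ∀ θ : Sph n, ((max (d θ) 0 : ℝ) : ℂ) *
          Complex.exp (inner ℝ (θ : Euc n) x * Complex.I) -
        ((max ((-d) θ) 0 : ℝ) : ℂ) * Complex.exp (inner ℝ (θ : Euc n) x * Complex.I) =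
        ((d θ * Real.cos (inner ℝ x (θ : Euc n)) : ℝ) : ℂ) +
          ((d θ * Real.sin (inner ℝ x (θ : Euc n)) : ℝ) : ℂ) * Complex.I := by
      intro θ
      have hm : max (d θ) 0 - max ((-d) θ) 0 = d θ := max_zero_sub_max_neg_zero_eq_self (d θ)
      rw [← sub_mul, ← Complex.ofReal_sub, hm, Complex.exp_mul_I, real_inner_comm]
      push_cast
      ring
    simp only [hpt]
    have hc : Continuous fun θ : Sph n => inner ℝ x (θ : Euc n) :=
      continuous_const.inner continuous_subtype_val
    have hi1 : Integrable (fun θ : Sph n => d θ * Real.cos (inner ℝ x (θ : Euc n))) σ :=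
      hd.mul_bdd (c := 1) (Real.continuous_cos.comp hc).aestronglyMeasurable
        (Eventually.of_forall fun θ => Real.abs_cos_le_one _)
    have hi2 : Integrable (fun θ : Sph n => d θ * Real.sin (inner ℝ x (θ : Euc n))) σ :=
      hd.mul_bdd (c := 1) (Real.continuous_sin.comp hc).aestronglyMeasurable
        (Eventually.of_forall fun θ => Real.abs_sin_le_one _)
    rw [integral_add hi1.ofReal (hi2.ofReal.mul_const _), integral_mul_const, integral_complex_ofReal,
      integral_complex_ofReal, hcos, hsin]
    simp
  have heq' : (σ.withDensity fun θ => ENNReal.ofReal (d θ)) =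
      σ.withDensity fun θ => ENNReal.ofReal ((-d) θ) := by
    rw [← hemb.comap_map (σ.withDensity fun θ => ENNReal.ofReal (d θ)), heq, hemb.comap_map]
  have hae := (withDensity_eq_iff hd.aemeasurable.ennreal_ofReal
    hd.neg.aemeasurable.ennreal_ofReal (hd.lintegral_lt_top).ne).mp heq'
  filter_upwards [hae] with θ hθ
  have := congrArg ENNReal.toReal hθ
  rw [ENNReal.toReal_ofReal', ENNReal.toReal_ofReal'] at this
  have hm : max (d θ) 0 - max ((-d) θ) 0 = d θ := max_zero_sub_max_neg_zero_eq_self (d θ)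
  rw [this, sub_self] at hm
  exact hm.symm

/-- The Funk transform is injective on even integrable functions. -/
theorem IsFunkInverse.ae_unique {k : ℕ} (hk : 1 ≤ k) (hkn : k < n) {φ : Grass n k → ℝ}
    {g₁ g₂ : Sph n → ℝ} (h₁ : IsFunkInverse hkn.le φ g₁) (h₂ : IsFunkInverse hkn.le φ g₂) :
    g₁ =ᵐ[surfaceMeasure n] g₂ := by
  set ξ : Grass n k := coordSubspace hkn.le
  have : Nontrivial ξ.1 := Module.nontrivial_of_finrank_pos (R := ℝ) (by rw [ξ.2]; omega)
  obtain ⟨θ₀⟩ : Nonempty (Metric.sphere (0 : ξ.1) 1) :=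
    (NormedSpace.sphere_nonempty.mpr zero_le_one).to_subtype
  have hξ : ξ.1 ≠ ⊤ := by
    intro h
    have h2 := ξ.2
    rw [h, finrank_top, finrank_euclideanSpace, Fintype.card_fin] at h2
    omega
  have hd := h₁.integrable.sub h₂.integrable
  have hae : ∀ {g : Sph n → ℝ}, IsFunkInverse hkn.le φ g →
      ∀ᵐ T : OrthGroup n ∂Measure.haar,
        ∫ θ, g (act T (sphereIncl ξ.1 θ)) ∂(volume : Measure ξ.1).toSphere = φ (rotate T ξ) := by
    -- `grassMeasure` is an image of Haar measure, so almost every subspace becomes almost every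
    -- rotation.
    intro g hg
    filter_upwards [ae_of_ae_map (continuous_rotate ξ).measurable.aemeasurable hg.funk_eq]
      with T hT
    rw [← funk_rotate, hT]
  have hzero : ∀ᵐ T : OrthGroup n ∂Measure.haar,
      ∫ θ, (g₁ - g₂) (act T (sphereIncl ξ.1 θ)) ∂(volume : Measure ξ.1).toSphere = 0 := by
    -- Splitting the integral of `g₁ - g₂` needs both functions integrable on the section, which
    -- holds for almost every `T`.
    filter_upwards [hae h₁, hae h₂,
      (integrable_act_prod ξ.1 h₁.integrable (sphereIncl ξ.1 θ₀)).prod_right_ae,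
      (integrable_act_prod ξ.1 h₂.integrable (sphereIncl ξ.1 θ₀)).prod_right_ae]
      with T e₁ e₂ i₁ i₂
    simp only [Pi.sub_apply]
    rw [integral_sub i₁ i₂, e₁, e₂, sub_self]
  have heven : ∀ θ, (g₁ - g₂) (-θ) = (g₁ - g₂) θ := fun θ => by
    simp [h₁.even θ, h₂.even θ]
  have h0 := ae_eq_zero_of_fourier hd
    (fun x => integral_mul_cos_eq_zero hd x (integral_mul_inner_pow_eq_zero hd x
      (integral_mul_pow_eq_zero hξ hd hzero θ₀ x)))
    (fun x => integral_mul_sin_eq_zero heven x)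
  filter_upwards [h0] with θ hθ
  exact sub_eq_zero.mp hθ

end Injectivity

end HalfSection

end

/-! ### Recovery of the radial function. -/

theorem corollary2p2 (m k : ℕ) (hk : 2 ≤ k) (hkm : k ≤ m)
    (K : Set (HalfSection.Euc (m + 1))) (hK : HalfSection.IsStarBody K)
    (ε : ℝ) (hε : ε = 1 ∨ ε = -1) :
    -- `F_k⁻¹ v^±` exists, with a version that is continuous on the hemisphere
    (∃ g : HalfSection.Sph (m + 1) → ℝ,
      HalfSection.IsFunkInverse (k := k) (Nat.le_succ_of_le hkm)
        (HalfSection.halfSectionVolume ε K) g ∧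
      ContinuousOn g (HalfSection.hemisphere m ε)) ∧
    -- every version recovers the radial function on the hemisphere
    ∀ g : HalfSection.Sph (m + 1) → ℝ,
      HalfSection.IsFunkInverse (k := k) (Nat.le_succ_of_le hkm)
        (HalfSection.halfSectionVolume ε K) g →
      (∀ᵐ θ ∂(HalfSection.surfaceMeasure (m + 1)), θ ∈ HalfSection.hemisphere m ε →
        HalfSection.radialFun K θ ^ k = 2 * k * g θ) ∧
      -- pointwise on the hemisphere and, by continuity, on the equator
      (ContinuousOn g (HalfSection.hemisphere m ε) →
        (∀ θ ∈ HalfSection.hemisphere m ε,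
          HalfSection.radialFun K θ ^ k = 2 * k * g θ) ∧
        ∀ θ : HalfSection.Sph (m + 1), (θ : HalfSection.Euc (m + 1)) (Fin.last m) = 0 →
          Tendsto (fun η => 2 * k * g η) (𝓝[HalfSection.hemisphere m ε] θ)
            (𝓝 (HalfSection.radialFun K θ ^ k))) := by
  have hk0 : (2 * k : ℝ) ≠ 0 := by positivity
  have h0 := HalfSection.isFunkInverse_evenRadialPow (ε := ε) hk (Nat.le_succ_of_le hkm) hK
  have hcont := HalfSection.continuousOn_evenRadialPow (k := k) (ε := ε) hK
  refine ⟨⟨_, h0, hcont⟩, fun g hg => ?_⟩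
  have hae := HalfSection.IsFunkInverse.ae_unique (by omega) (Nat.lt_succ_of_le hkm) hg h0
  have hval : ∀ θ ∈ HalfSection.hemisphere m ε,
      g θ = HalfSection.evenRadialPow k ε K θ → HalfSection.radialFun K θ ^ k = 2 * k * g θ := by
    intro θ hθ h
    rw [h, HalfSection.evenRadialPow_of_mem hθ, mul_div_cancel₀ _ hk0]
  refine ⟨?_, fun hgc => ?_⟩
  · filter_upwards [hae] with θ h hθ
    exact hval θ hθ h
  -- Surface measure charges every nonempty open set, so continuous functions that agree almost
  -- everywhere on the open hemisphere agree throughout it.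
  have heq := Measure.eqOn_open_of_ae_eq (ae_restrict_of_ae hae)
    (HalfSection.isOpen_hemisphere m ε) hgc hcont
  refine ⟨fun θ hθ => hval θ hθ (heq hθ), fun θ _ => ?_⟩
  -- On the hemisphere `2k g` coincides with `ρ_K^k`, which is continuous on the whole sphere.
  refine (((hK.continuous_radialFun.pow k).tendsto θ).mono_left nhdsWithin_le_nhds).congr' ?_
  filter_upwards [self_mem_nhdsWithin] with η hη
  exact hval η hη (heq hη)
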